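/- A \emph{Nevanlinna function} is a meromorphic function $f:\mathbf{C}\to\overline{\mathbf{C}}$, with $f'\not\equiv 0$, satisfying $$\frac{f'''}{f'}-\frac32\left(\frac{f''}{f'}\right)^2=2P$$ for some polynomial $P$; it is called \emph{real} if $f(\mathbf{R})\subset\mathbf{R}\cup\{\infty\}$. A point $a\in\overline{\mathbf{C}}$ is an \emph{asymptotic value} of $f$ if $f(\gamma(t))\to a$ as $t\to\infty$ for some curve $\gamma:[0,\infty)\to\mathbf{C}$ with $\gamma(t)\to\infty$. Let $A\subset\overline{\mathbf{C}}$ be a finite set such that $f:\mathbf{C}\setminus f^{-1}(A)\to\overline{\mathbf{C}}\setminus A$ is a covering, and for each $a\in A$ let $D_a\subset\overline{\mathbf{C}}$ be an open topological disc with $D_a\cap A=\{a\}$. A \emph{logarithmic singularity} of $f$ over $a\in A$ is a connected component $V$ of $f^{-1}(D_a\setminus\{a\})$ such that the covering $f:V\to D_a\setminus\{a\}$ has infinite degree; the number of logarithmic singularities does not depend on the choice of $A$ and of the discs $D_a$. \textbf{Statement.} If a real Nevanlinna function has at least three logarithmic singularities and all its asymptotic values lie in $\mathbf{R}\cup\{\infty\}$,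 then it has at most one real zero. -/

import Mathlib

open Filter Topology Set

noncomputable section

namespace NevanlinnaFunctions

/-- The map `ℂ → ℂ ∪ {∞}` defined by a meromorphic function: its value is `∞` at the poles, and at
every other point it is the value of the analytic continuation of `f` to that point (the value
`f z` itself plays no role when `z` is a pole or a removable singularity). -/
def toSphere (f : ℂ → ℂ) (z : ℂ) : OnePoint ℂ :=
  open Classical in
  if meromorphicOrderAt f z < 0 then OnePoint.infty
  else ((toMeromorphicNFAt f z z : ℂ) : OnePoint ℂ)

/-- The extended real line `ℝ ∪ {∞}` inside the Riemann sphere. -/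
def extendedRealLine : Set (OnePoint ℂ) :=
  insert OnePoint.infty (Set.range fun x : ℝ => ((x : ℂ) : OnePoint ℂ))

/-- The Schwarzian derivative `f''' / f' - (3/2) (f'' / f')²`. -/
def schwarzian (f : ℂ → ℂ) (z : ℂ) : ℂ :=
  iteratedDeriv 3 f z / deriv f z - 3 / 2 * (iteratedDeriv 2 f z / deriv f z) ^ 2

/-- A Nevanlinna function: a meromorphic function in the plane, with `f'` not identically zero,
whose Schwarzian derivative is `2 P` for some polynomial `P`. The equation is an identity between
meromorphic functions, that is, it holds outside a closed discrete set. -/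
def IsNevanlinna (f : ℂ → ℂ) : Prop :=
  Meromorphic f ∧ ∃ P : Polynomial ℂ,
    ∀ᶠ z in codiscrete ℂ, deriv f z ≠ 0 ∧ schwarzian f z = 2 * P.eval z

/-- A real meromorphic function: it maps the real line into `ℝ ∪ {∞}`. -/
def IsReal (f : ℂ → ℂ) : Prop :=
  ∀ x : ℝ, toSphere f x ∈ extendedRealLine

/-- `a` is an asymptotic value of `f`: the limit of `f` along some curve tending to `∞`. -/
def IsAsymptoticValue (f : ℂ → ℂ) (a : OnePoint ℂ) : Prop :=
  ∃ γ : ℝ → ℂ, ContinuousOn γ (Ici 0) ∧ Tendsto γ atTop (cocompact ℂ) ∧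
    Tendsto (fun t => toSphere f (γ t)) atTop (𝓝 a)

/-- `A` is a set of base points of `f`: it is finite, and `f` is a covering over its complement. -/
def IsBaseSet (f : ℂ → ℂ) (A : Set (OnePoint ℂ)) : Prop :=
  A.Finite ∧ IsCoveringMapOn (toSphere f) Aᶜ

/-- `D` assigns to each `a ∈ A` an open topological disc whose only point in `A` is `a`. -/
def IsolatingDiscs (A : Set (OnePoint ℂ)) (D : OnePoint ℂ → Set (OnePoint ℂ)) : Prop :=
  ∀ a ∈ A, IsOpen (D a) ∧ Nonempty (D a ≃ₜ Metric.ball (0 : ℂ) 1) ∧ D a ∩ A = {a}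

/-- The logarithmic singularities of `f`, relative to base points `A` and discs `D`: the pairs
`(a, V)` where `a ∈ A` and `V` is a connected component of the preimage of the punctured disc
`D a \ {a}` such that the covering `V → D a \ {a}` has infinite degree. -/
def logSingularities (f : ℂ → ℂ) (A : Set (OnePoint ℂ)) (D : OnePoint ℂ → Set (OnePoint ℂ)) :
    Set (OnePoint ℂ × Set ℂ) :=
  {p | p.1 ∈ A ∧
    (∃ z ∈ toSphere f ⁻¹' (D p.1 \ {p.1}),
      p.2 = connectedComponentIn (toSphere f ⁻¹' (D p.1 \ {p.1})) z) ∧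
    ∀ w ∈ D p.1 \ {p.1}, (p.2 ∩ toSphere f ⁻¹' {w}).Infinite}

/-- `f` has at least `n` logarithmic singularities. Their number does not depend on the choice of
the base points and of the discs. -/
def HasAtLeastLogSingularities (f : ℂ → ℂ) (n : ℕ) : Prop :=
  ∃ (A : Set (OnePoint ℂ)) (D : OnePoint ℂ → Set (OnePoint ℂ)),
    IsBaseSet f A ∧ IsolatingDiscs A D ∧ (n : ℕ∞) ≤ (logSingularities f A D).encard

end NevanlinnaFunctions

end

/-! A continuous Schwarzian derivative forces `f'` to have order `0` or `-2` at every point, so `f`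
is a local homeomorphism to the sphere. Since `f` is real and locally injective, a thin strip above
a real interval is mapped into one of the two half-spheres bounded by `ℝ ∪ {∞}`, and the strip
below it into the other one. The half-sphere is simply connected and contains no asymptotic value,
so every germ of `f⁻¹` continues over all of it, and `f` is injective on the strip. If `f x = f y`
for two real points `x ≠ y`, then `f`, being open, takes near `x` and near `y` the same values in
the half-sphere, necessarily inside the strip, which is a contradiction. -/

namespace NevanlinnaFunctions

section PathLifting

variable {E Y : Type*} {p : E → Y} {a : Y} {c : ℝ → Y} {e₀ : E} {b : ℝ}
  {δ δ' : ℝ → E}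

theorem tendsto_comp_lift [TopologicalSpace Y] (hc : Continuous c) (hb : 0 < b)
    (hl : ∀ t ∈ Ico 0 b, p (δ t) = c t) :
    Tendsto (p ∘ δ) (𝓝[<] b) (𝓝 (c b)) :=
  ((hc.tendsto b).mono_left nhdsWithin_le_nhds).congr'
    (by filter_upwards [Ico_mem_nhdsLT hb] with t ht using (hl t ht).symm)

variable [TopologicalSpace E]

/-- `δ` lifts the path `c` through `p` on the interval `[0, b]`, starting at `e₀`. -/
structure IsPathLift (p : E → Y) (c : ℝ → Y) (e₀ : E) (b : ℝ) (δ : ℝ → E) : Prop where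
  continuousOn : ContinuousOn δ (Icc 0 b)
  map_eq : ∀ t ∈ Icc 0 b, p (δ t) = c t
  map_zero : δ 0 = e₀

theorem IsPathLift.mono (h : IsPathLift p c e₀ b δ) {b' : ℝ} (hb : b' ≤ b) :
    IsPathLift p c e₀ b' δ :=
  ⟨h.continuousOn.mono (Icc_subset_Icc_right hb), fun t ht => h.map_eq t ⟨ht.1, ht.2.trans hb⟩,
    h.map_zero⟩

theorem exists_mapClusterPt_of_not_tendsto_cocompact {α : Type*} {l : Filter α} {u : α → E}
    (h : ¬ Tendsto u l (cocompact E)) : ∃ e, MapClusterPt e l u := by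
  simp only [hasBasis_cocompact.tendsto_right_iff, not_forall, not_eventually, mem_compl_iff,
    not_not] at h
  obtain ⟨s, hs, hfreq⟩ := h
  exact (hs.exists_mapClusterPt_of_frequently hfreq).imp fun _ => And.right

variable [TopologicalSpace Y]

/-- `a` is an asymptotic value of `p`: the limit of `p` along a curve that leaves every compact
set. For `p = toSphere f` this is `IsAsymptoticValue f a` by definition. -/
def HasAsymptoticValue (p : E → Y) (a : Y) : Prop :=
  ∃ γ : ℝ → E, ContinuousOn γ (Ici 0) ∧ Tendsto γ atTop (cocompact E) ∧
    Tendsto (fun t => p (γ t)) atTop (𝓝 a)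

/-- `t ↦ b - b / (1 + t)` reparametrizes `[0, b)` by `[0, ∞)`. -/
theorem hasAsymptoticValue_of_tendsto_nhdsLT (hb : 0 < b) (hδ : ContinuousOn δ (Ico 0 b))
    (hcocompact : Tendsto δ (𝓝[<] b) (cocompact E))
    (hlim : Tendsto (p ∘ δ) (𝓝[<] b) (𝓝 a)) : HasAsymptoticValue p a := by
  let φ : ℝ → ℝ := fun t => b - b / (1 + t)
  have hmaps : MapsTo φ (Ici 0) (Ico 0 b) := fun t (ht : 0 ≤ t) =>
    ⟨sub_nonneg.2 (div_le_self hb.le (by linarith)), sub_lt_self b (by positivity)⟩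
  have hcont : ContinuousOn φ (Ici 0) := fun t (ht : 0 ≤ t) => by
    have : 1 + t ≠ 0 := by positivity
    exact (by fun_prop (disch := assumption) : ContinuousAt φ t).continuousWithinAt
  have htendsto : Tendsto φ atTop (𝓝[<] b) := by
    refine tendsto_nhdsWithin_iff.2 ⟨?_, ?_⟩
    · have : Tendsto (fun t : ℝ => b / (1 + t)) atTop (𝓝 0) :=
        tendsto_const_nhds.div_atTop (tendsto_atTop_add_const_left _ _ tendsto_id)
      simpa [φ] using tendsto_const_nhds.sub this
    · filter_upwards [eventually_ge_atTop 0] with t ht using (hmaps ht).2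
  exact ⟨δ ∘ φ, hδ.comp hcont hmaps, hcocompact.comp htendsto, hlim.comp htendsto⟩

theorem IsPathLift.exists_gt (hp : IsLocalHomeomorph p) (hc : Continuous c) (hb : 0 ≤ b)
    (h : IsPathLift p c e₀ b δ) : ∃ b' > b, ∃ δ', IsPathLift p c e₀ b' δ' := by
  obtain ⟨q, hq, rfl⟩ := hp (δ b)
  have hcb : c b = q (δ b) := (h.map_eq b (right_mem_Icc.2 hb)).symm
  obtain ⟨b', hb', hsub⟩ := mem_nhdsGE_iff_exists_Icc_subset.1
    (hc.continuousAt.continuousWithinAt.eventually_mem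
      (q.open_target.mem_nhds (hcb ▸ q.map_source hq)))
  let δ' : ℝ → E := fun t => if t ≤ b then δ t else q.symm (c t)
  have hleft : EqOn δ' δ (Icc 0 b) := fun t ht => if_pos ht.2
  have hright : EqOn δ' (q.symm ∘ c) (Icc b b') := fun t ht => by
    rcases ht.1.eq_or_lt with rfl | hbt
    · simp [δ', hcb, q.left_inv hq]
    · simp [δ', hbt.not_ge]
  refine ⟨b', hb', δ', ?_, fun t ht => ?_, (hleft (left_mem_Icc.2 hb)).trans h.map_zero⟩
  · rw [← Icc_union_Icc_eq_Icc hb (le_of_lt hb')]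
    exact (h.continuousOn.congr hleft).union_of_isClosed
      ((q.continuousOn_symm.comp hc.continuousOn hsub).congr hright) isClosed_Icc isClosed_Icc
  · rcases le_total t b with htb | hbt
    · rw [hleft ⟨ht.1, htb⟩, h.map_eq t ⟨ht.1, htb⟩]
    · rw [hright ⟨hbt, ht.2⟩, Function.comp_apply, q.right_inv (hsub ⟨hbt, ht.2⟩)]

variable [T2Space E]

theorem IsPathLift.eqOn (hp : IsLocalHomeomorph p) (h : IsPathLift p c e₀ b δ)
    (h' : IsPathLift p c e₀ b δ') : EqOn δ δ' (Icc 0 b) := fun _ ht =>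
  (T2Space.isSeparatedMap p).eqOn_of_comp_eqOn hp.isLocallyInjective isPreconnected_Icc
    h.continuousOn h'.continuousOn (fun s hs => (h.map_eq s hs).trans (h'.map_eq s hs).symm)
    (left_mem_Icc.2 (ht.1.trans ht.2)) (h.map_zero.trans h'.map_zero.symm) ht

theorem eqOn_symm_comp_of_isPreconnected (q : OpenPartialHomeomorph E Y)
    (hq : IsLocalHomeomorph q) {J : Set ℝ} (hJ : IsPreconnected J) (hc : ContinuousOn c J)
    (hδ : ContinuousOn δ J) (hl : ∀ t ∈ J, q (δ t) = c t) (hcJ : MapsTo c J q.target) {t : ℝ}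
    (ht : t ∈ J) (hts : δ t ∈ q.source) : EqOn δ (q.symm ∘ c) J := by
  refine (T2Space.isSeparatedMap q).eqOn_of_comp_eqOn hq.isLocallyInjective hJ hδ
    (q.continuousOn_symm.comp hc hcJ) (fun s hs => ?_) ht ?_
  · simp [hl s hs, q.right_inv (hcJ hs)]
  · simp [← hl t ht, q.left_inv hts]

theorem exists_lift_Ico (hp : IsLocalHomeomorph p) (hb : 0 < b)
    (h : ∀ t ∈ Ico 0 b, ∃ δ, IsPathLift p c e₀ t δ) :
    ∃ δ : ℝ → E, ContinuousOn δ (Ico 0 b) ∧ (∀ t ∈ Ico 0 b, p (δ t) = c t) ∧ δ 0 = e₀ := by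
  have : Nonempty E := ⟨e₀⟩
  choose! Γ hΓ using h
  have heqOn : ∀ s ∈ Ico 0 b, EqOn (fun t => Γ t t) (Γ s) (Icc 0 s) := fun s hs t ht =>
    (hΓ t ⟨ht.1, ht.2.trans_lt hs.2⟩).eqOn hp ((hΓ s hs).mono ht.2) (right_mem_Icc.2 ht.1)
  refine ⟨fun t => Γ t t, fun t ht => ?_,
    fun t ht => (hΓ t ht).map_eq t (right_mem_Icc.2 ht.1), (hΓ 0 ⟨le_rfl, hb⟩).map_zero⟩
  obtain ⟨s, hts, hsb⟩ := exists_between ht.2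
  have hs : s ∈ Ico 0 b := ⟨ht.1.trans hts.le, hsb⟩
  refine (((hΓ s hs).continuousOn.congr (heqOn s hs)) t ⟨ht.1, hts.le⟩).mono_of_mem_nhdsWithin ?_
  filter_upwards [self_mem_nhdsWithin, mem_nhdsWithin_of_mem_nhds (Iio_mem_nhds hts)]
    with u hu hus using ⟨hu.1, le_of_lt hus⟩

variable [T2Space Y]

theorem tendsto_of_mapClusterPt_lift (hp : IsLocalHomeomorph p) (hc : Continuous c)
    (hb : 0 < b) (hδ : ContinuousOn δ (Ico 0 b)) (hl : ∀ t ∈ Ico 0 b, p (δ t) = c t) {e : E}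
    (he : MapClusterPt e (𝓝[<] b) δ) : Tendsto δ (𝓝[<] b) (𝓝 e) := by
  have hpδ := tendsto_comp_lift hc hb hl
  have hpe : p e = c b :=
    eq_of_nhds_neBot
      ((he.continuousAt_comp hp.continuous.continuousAt).neBot.mono (inf_le_inf_left _ hpδ))
  obtain ⟨q, hq, rfl⟩ := hp e
  have hcb : c b ∈ q.target := hpe ▸ q.map_source hq
  obtain ⟨t₀, ht₀, hsub⟩ := mem_nhdsLT_iff_exists_Ico_subset.1
    (hc.continuousAt.continuousWithinAt.eventually_mem (q.open_target.mem_nhds hcb))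
  obtain ⟨t₁, hsource, ht₁⟩ := ((he.frequently (q.open_source.mem_nhds hq)).and_eventually
    (Ico_mem_nhdsLT (max_lt hb ht₀))).exists
  have heq : EqOn δ (q.symm ∘ c) (Ico t₁ b) :=
    eqOn_symm_comp_of_isPreconnected q hp isPreconnected_Ico hc.continuousOn
      (hδ.mono (Ico_subset_Ico_left ((le_max_left _ _).trans ht₁.1)))
      (fun t ht => hl t ⟨(le_max_left _ _).trans (ht₁.1.trans ht.1), ht.2⟩)
      (fun t ht => hsub ⟨(le_max_right _ _).trans (ht₁.1.trans ht.1), ht.2⟩)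
      (left_mem_Ico.2 ht₁.2) hsource
  have hlim : Tendsto (q.symm ∘ c) (𝓝[<] b) (𝓝 e) := by
    have := (q.continuousAt_symm hcb).tendsto.comp (hc.tendsto b)
    rw [← hpe, q.left_inv hq] at this
    exact this.mono_left nhdsWithin_le_nhds
  exact hlim.congr' (by filter_upwards [Ico_mem_nhdsLT ht₁.2] with t ht using (heq ht).symm)

theorem exists_tendsto_lift_of_not_hasAsymptoticValue (hp : IsLocalHomeomorph p)
    (hc : Continuous c) (hb : 0 < b) (ha : ¬ HasAsymptoticValue p (c b))
    (hδ : ContinuousOn δ (Ico 0 b)) (hl : ∀ t ∈ Ico 0 b, p (δ t) = c t) :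
    ∃ e, p e = c b ∧ Tendsto δ (𝓝[<] b) (𝓝 e) := by
  have hpδ := tendsto_comp_lift hc hb hl
  obtain ⟨e, he⟩ := exists_mapClusterPt_of_not_tendsto_cocompact fun h =>
    ha (hasAsymptoticValue_of_tendsto_nhdsLT hb hδ h hpδ)
  have hlim := tendsto_of_mapClusterPt_lift hp hc hb hδ hl he
  exact ⟨e, tendsto_nhds_unique ((hp.continuous.tendsto e).comp hlim) hpδ, hlim⟩

theorem exists_isPathLift_of_forall_lt (hp : IsLocalHomeomorph p) (hc : Continuous c)
    (hb : 0 < b) (ha : ¬ HasAsymptoticValue p (c b))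
    (h : ∀ t ∈ Ico 0 b, ∃ δ, IsPathLift p c e₀ t δ) : ∃ δ, IsPathLift p c e₀ b δ := by
  obtain ⟨δ, hδ, hl, h0⟩ := exists_lift_Ico hp hb h
  obtain ⟨e, hpe, hlim⟩ := exists_tendsto_lift_of_not_hasAsymptoticValue hp hc hb ha hδ hl
  refine ⟨Function.update δ b e, ?_, fun t ht => ?_, by rwa [Function.update_of_ne hb.ne]⟩
  · rw [continuousOn_update_iff, Icc_sdiff_right]
    exact ⟨hδ, fun _ => hlim.mono_left (nhdsWithin_mono _ fun t ht => ht.2)⟩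
  · rcases ht.2.eq_or_lt with rfl | htb
    · simpa using hpe
    · simpa [Function.update_of_ne htb.ne] using hl t ⟨ht.1, htb⟩

theorem exists_isPathLift (hp : IsLocalHomeomorph p) (hc : Continuous c)
    (ha : ∀ t, ¬ HasAsymptoticValue p (c t)) (h₀ : p e₀ = c 0) (b : ℝ) :
    ∃ δ, IsPathLift p c e₀ b δ := by
  by_contra hb
  let S : Set ℝ := {t | 0 ≤ t ∧ ∃ δ, IsPathLift p c e₀ t δ}
  have hS0 : 0 ∈ S := by
    refine ⟨le_rfl, fun _ => e₀, continuousOn_const, fun t ht => ?_, rfl⟩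
    rw [Icc_self, mem_singleton_iff] at ht
    rw [ht, h₀]
  have hSb : BddAbove S := ⟨b, fun _ ⟨_, δ, hδ⟩ => le_of_not_gt fun hbt => hb ⟨δ, hδ.mono hbt.le⟩⟩
  have hsup : sSup S ∈ S := by
    have hnonneg : 0 ≤ sSup S := le_csSup hSb hS0
    refine ⟨hnonneg, ?_⟩
    rcases hnonneg.eq_or_lt with h | hpos
    · exact h ▸ hS0.2
    refine exists_isPathLift_of_forall_lt hp hc hpos (ha _) fun t ht => ?_
    obtain ⟨s, hs, hts⟩ := exists_lt_of_lt_csSup ⟨0, hS0⟩ ht.2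
    exact hs.2.imp fun δ hδ => hδ.mono hts.le
  obtain ⟨δ, hδ⟩ := hsup.2
  obtain ⟨b', hb', hδ'⟩ := hδ.exists_gt hp hc hsup.1
  exact (le_csSup hSb ⟨hsup.1.trans hb'.le, hδ'⟩).not_gt hb'

open scoped unitInterval

theorem exists_path_lift_unitInterval (hp : IsLocalHomeomorph p) (γ : C(I, Y))
    (ha : ∀ t, ¬ HasAsymptoticValue p (γ t)) (h₀ : p e₀ = γ 0) :
    ∃ Γ : C(I, E), Γ 0 = e₀ ∧ p ∘ Γ = γ := by
  obtain ⟨δ, hδ⟩ := exists_isPathLift (c := IccExtend zero_le_one γ) hp γ.continuous.Icc_extend'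
    (fun _ => ha _) (by simpa using h₀) 1
  refine ⟨⟨fun t => δ t, hδ.continuousOn.comp_continuous continuous_subtype_val fun t => t.2⟩,
    hδ.map_zero, funext fun t => ?_⟩
  simpa using hδ.map_eq t t.2

theorem lift_one_eq_of_simplyConnectedSpace {A : Type*} [TopologicalSpace A]
    [SimplyConnectedSpace A] (hp : IsLocalHomeomorph p) (f : C(A, Y))
    (ha : ∀ x, ¬ HasAsymptoticValue p (f x)) {γ γ' : C(I, A)} {Γ Γ' : C(I, E)}
    (hγ : γ 0 = γ' 0) (hγ₁ : γ 1 = γ' 1) (hΓ₀ : Γ 0 = Γ' 0) (hΓ : p ∘ Γ = f.comp γ)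
    (hΓ' : p ∘ Γ' = f.comp γ') : Γ 1 = Γ' 1 := by
  let P : Path (γ 0) (γ 1) := ⟨γ, rfl, rfl⟩
  let P' : Path (γ 0) (γ 1) := ⟨γ', hγ.symm, hγ₁.symm⟩
  obtain ⟨H⟩ := SimplyConnectedSpace.paths_homotopic P P'
  have hstage (t : I) : ∃ Λ : C(I, E), Λ 0 = Γ 0 ∧ p ∘ Λ = f.comp (H.eval t) :=
    exists_path_lift_unitInterval hp _ (fun _ => ha _)
      ((congrFun hΓ 0).trans (congrArg f (H.eval t).source.symm))
  choose Λ hΛ₀ hΛ using hstage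
  have sep := T2Space.isSeparatedMap p
  have hfirst : Λ 0 = Γ := DFunLike.coe_injective <| sep.eq_of_comp_eq hp.isLocallyInjective
    (Λ 0).continuous Γ.continuous (by rw [hΛ, hΓ, H.eval_zero]; rfl) 0 (hΛ₀ 0)
  have hlast : Λ 1 = Γ' := DFunLike.coe_injective <| sep.eq_of_comp_eq hp.isLocallyInjective
    (Λ 1).continuous Γ'.continuous (by rw [hΛ, hΓ', H.eval_one]; rfl) 0 ((hΛ₀ 1).trans hΓ₀)
  rw [← hfirst, ← hlast]
  exact (hp.monodromy_theorem sep (H.compContinuousMap f) Λ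
    (fun t s => congrFun (hΛ t) s) (fun t => (hΛ₀ t).trans (hΛ₀ 0).symm) 1).symm

theorem exists_continuousMap_lift_of_simplyConnectedSpace {A : Type*} [TopologicalSpace A]
    [SimplyConnectedSpace A] [LocallyPathConnectedSpace A] (hp : IsLocalHomeomorph p) (f : C(A, Y))
    (ha : ∀ x, ¬ HasAsymptoticValue p (f x)) {a₀ : A} (h₀ : p e₀ = f a₀) :
    ∃ s : C(A, E), s a₀ = e₀ ∧ p ∘ s = f :=
  (hp.existsUnique_continuousMap_lifts f a₀ e₀ h₀
    (fun γ hγ => exists_path_lift_unitInterval hp (f.comp γ) (fun _ => ha _)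
      (h₀.trans (congrArg f hγ.symm)))
    (fun _ _ _ _ hγ hγ' hΓ hΓ' hl hl' h₁ => lift_one_eq_of_simplyConnectedSpace hp f ha
      (hγ.trans hγ'.symm) h₁ (hΓ.trans hΓ'.symm) hl hl')).exists

/-- If `s` is the section of `p` over `K` with `s (p x) = x`, then `s ∘ p` and `id` are two lifts
of `p` on `V` that agree at `x`, so `s` inverts `p` on `V`. -/
theorem injOn_of_isSimplyConnected (hp : IsLocalHomeomorph p) {K : Set Y}
    (hK : IsSimplyConnected K) [LocallyPathConnectedSpace K]
    (ha : ∀ y ∈ K, ¬ HasAsymptoticValue p y) {V : Set E} (hV : IsPreconnected V)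
    (hVK : MapsTo p V K) : InjOn p V := by
  intro x hx y hy hxy
  have := hK.simplyConnectedSpace
  obtain ⟨s, hsx, hs⟩ := exists_continuousMap_lift_of_simplyConnectedSpace hp
    ⟨((↑) : K → Y), continuous_subtype_val⟩ (fun y => ha y y.2) (a₀ := ⟨p x, hVK hx⟩) (e₀ := x) rfl
  let pV : V → K := fun v => ⟨p v, hVK v.2⟩
  have : PreconnectedSpace V := isPreconnected_iff_preconnectedSpace.1 hV
  have hspV : s ∘ pV = (↑) :=
    (T2Space.isSeparatedMap p).eq_of_comp_eq hp.isLocallyInjective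
      (s.continuous.comp (by have := hp.continuous; fun_prop)) continuous_subtype_val
      (funext fun v => congrFun hs (pV v)) ⟨x, hx⟩ hsx
  have hpV : pV ⟨x, hx⟩ = pV ⟨y, hy⟩ := Subtype.ext hxy
  exact (congrFun hspV ⟨x, hx⟩).symm.trans ((congrArg s hpV).trans (congrFun hspV ⟨y, hy⟩))

end PathLifting

section Inversion

variable {𝕜 : Type*} [NormedField 𝕜]

open Classical in
/-- The inversion `w ↦ 1 / w` of `𝕜 ∪ {∞}`, exchanging `0` and `∞`; it turns poles into zeros. -/
noncomputable def sphereInv (a : OnePoint 𝕜) : OnePoint 𝕜 :=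
  a.elim ((0 : 𝕜) : OnePoint 𝕜) fun w =>
    if w = 0 then OnePoint.infty else ((w⁻¹ : 𝕜) : OnePoint 𝕜)

theorem sphereInv_infty : sphereInv (OnePoint.infty : OnePoint 𝕜) = ((0 : 𝕜) : OnePoint 𝕜) := rfl

theorem sphereInv_zero : sphereInv ((0 : 𝕜) : OnePoint 𝕜) = OnePoint.infty := if_pos rfl

theorem sphereInv_coe {w : 𝕜} (hw : w ≠ 0) :
    sphereInv (w : OnePoint 𝕜) = ((w⁻¹ : 𝕜) : OnePoint 𝕜) := if_neg hw

theorem sphereInv_involutive : Function.Involutive (sphereInv : OnePoint 𝕜 → OnePoint 𝕜) := by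
  intro a
  induction a using OnePoint.rec with
  | infty => rw [sphereInv_infty, sphereInv_zero]
  | coe w =>
    rcases eq_or_ne w 0 with rfl | hw
    · rw [sphereInv_zero, sphereInv_infty]
    · rw [sphereInv_coe hw, sphereInv_coe (inv_ne_zero hw), inv_inv]

theorem continuous_sphereInv [ProperSpace 𝕜] :
    Continuous (sphereInv : OnePoint 𝕜 → OnePoint 𝕜) := by
  have hcob : coclosedCompact 𝕜 = Bornology.cobounded 𝕜 := by
    rw [coclosedCompact_eq_cocompact, Metric.cobounded_eq_cocompact]
  refine (OnePoint.continuous_iff _).2 ⟨?_, continuous_iff_continuousAt.2 fun w => ?_⟩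
  · rw [hcob, sphereInv_infty]
    refine ((OnePoint.continuous_coe.tendsto 0).comp tendsto_inv₀_cobounded).congr' ?_
    filter_upwards [Bornology.eventually_ne_cobounded (0 : 𝕜)] with w hw
      using (sphereInv_coe hw).symm
  · rcases eq_or_ne w 0 with rfl | hw
    · rw [continuousAt_iff_punctured_nhds, sphereInv_zero]
      refine ((hcob ▸ OnePoint.tendsto_coe_infty).comp tendsto_inv₀_nhdsNE_zero).congr' ?_
      filter_upwards [self_mem_nhdsWithin] with w hw using (sphereInv_coe hw).symm
    · refine (OnePoint.continuous_coe.continuousAt.comp (continuousAt_inv₀ hw)).congr ?_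
      filter_upwards [eventually_ne_nhds hw] with v hv using (sphereInv_coe hv).symm

theorem isHomeomorph_sphereInv [ProperSpace 𝕜] :
    IsHomeomorph (sphereInv : OnePoint 𝕜 → OnePoint 𝕜) :=
  (Homeomorph.mk sphereInv_involutive.toPerm continuous_sphereInv continuous_sphereInv).isHomeomorph

end Inversion

section HalfSphere

theorem coe_mem_extendedRealLine_iff {w : ℂ} : (w : OnePoint ℂ) ∈ extendedRealLine ↔ w.im = 0 := by
  constructor
  · rintro (h | ⟨x, hx⟩)
    · exact absurd h (OnePoint.coe_ne_infty w)
    · rw [← OnePoint.coe_injective hx, Complex.ofReal_im]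
  · exact fun h => Or.inr ⟨w.re, congrArg _ (Complex.ext rfl h.symm)⟩

theorem sphereInv_mem_extendedRealLine_iff {a : OnePoint ℂ} :
    sphereInv a ∈ extendedRealLine ↔ a ∈ extendedRealLine := by
  induction a using OnePoint.rec with
  | infty => simp [sphereInv_infty, extendedRealLine]
  | coe w =>
    rcases eq_or_ne w 0 with rfl | hw
    · simp [sphereInv_zero, extendedRealLine]
    · simp [sphereInv_coe hw, coe_mem_extendedRealLine_iff, Complex.inv_im, hw]

/-- The open half of the Riemann sphere lying over the half-plane `{s * Im w > 0}`: the upper one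
when `0 < s` and the lower one when `s < 0`. -/
def halfSphere (s : ℝ) : Set (OnePoint ℂ) := (↑) '' {w : ℂ | 0 < s * w.im}

variable {s : ℝ}

theorem coe_mem_halfSphere_iff {w : ℂ} : (w : OnePoint ℂ) ∈ halfSphere s ↔ 0 < s * w.im :=
  OnePoint.coe_injective.mem_set_image

theorem isOpen_setOf_pos_mul_im : IsOpen {w : ℂ | 0 < s * w.im} :=
  isOpen_lt continuous_const (by fun_prop)

theorem convex_setOf_pos_mul_im : Convex ℝ {w : ℂ | 0 < s * w.im} :=
  (convex_Ioi 0).is_linear_preimage (s • Complex.imCLM).isLinear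

theorem isOpen_halfSphere : IsOpen (halfSphere s) :=
  OnePoint.isOpenEmbedding_coe.isOpenMap _ isOpen_setOf_pos_mul_im

theorem isSimplyConnected_halfSphere (hs : s ≠ 0) : IsSimplyConnected (halfSphere s) := by
  have hne : {w : ℂ | 0 < s * w.im}.Nonempty :=
    ⟨s * Complex.I, by simpa using mul_self_pos.2 hs⟩
  have := convex_setOf_pos_mul_im.contractibleSpace hne
  exact OnePoint.isOpenEmbedding_coe.isEmbedding.isSimplyConnected_image.2
    (SimplyConnectedSpace.ofContractible _)

instance : LocallyPathConnectedSpace (halfSphere s) := by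
  have := isOpen_setOf_pos_mul_im (s := s) |>.locallyPathConnectedSpace
  exact (OnePoint.isOpenEmbedding_coe.isEmbedding.homeomorphImage
    {w : ℂ | 0 < s * w.im}).symm.isOpenEmbedding.locallyPathConnectedSpace

theorem disjoint_halfSphere_extendedRealLine : Disjoint (halfSphere s) extendedRealLine := by
  refine disjoint_left.2 ?_
  rintro _ ⟨w, hw, rfl⟩ h
  rw [coe_mem_extendedRealLine_iff] at h
  simp [h] at hw

theorem disjoint_halfSphere_neg : Disjoint (halfSphere s) (halfSphere (-s)) := by
  refine disjoint_left.2 ?_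
  rintro _ ⟨w, hw : 0 < s * w.im, rfl⟩ h
  rw [coe_mem_halfSphere_iff] at h
  linarith

theorem mem_halfSphere_or_mem_halfSphere_neg (hs : s ≠ 0) {a : OnePoint ℂ}
    (ha : a ∉ extendedRealLine) : a ∈ halfSphere s ∨ a ∈ halfSphere (-s) := by
  induction a using OnePoint.rec with
  | infty => exact absurd (mem_insert _ _) ha
  | coe w =>
    rw [coe_mem_extendedRealLine_iff] at ha
    simp only [coe_mem_halfSphere_iff, neg_mul, neg_pos]
    exact (mul_ne_zero hs ha).lt_or_gt.symm

theorem extendedRealLine_subset_closure_halfSphere (hs : s ≠ 0) :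
    extendedRealLine ⊆ closure (halfSphere s) := by
  have hmem (x : ℝ) {t : ℝ} (ht : 0 < t) :
      ((x + t * (s * Complex.I) : ℂ) : OnePoint ℂ) ∈ halfSphere s := by
    rw [coe_mem_halfSphere_iff]
    have : 0 < s * (t * s) := by nlinarith [mul_pos ht (mul_self_pos.2 hs)]
    simpa using this
  rintro _ (rfl | ⟨x, rfl⟩)
  · have hlim : Tendsto (fun t : ℝ => (t * (s * Complex.I) : ℂ)) atTop (coclosedCompact ℂ) := by
      rw [coclosedCompact_eq_cocompact, ← Metric.cobounded_eq_cocompact,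
        ← tendsto_norm_atTop_iff_cobounded]
      simpa using tendsto_abs_atTop_atTop.atTop_mul_const (abs_pos.2 hs)
    refine mem_closure_of_tendsto (OnePoint.tendsto_coe_infty.comp hlim) ?_
    filter_upwards [eventually_gt_atTop 0] with t ht using by simpa using hmem 0 ht
  · have hlim : Tendsto (fun t : ℝ => (x + t * (s * Complex.I) : ℂ)) (𝓝[>] 0) (𝓝 x) := by
      have : Continuous fun t : ℝ => (x + t * (s * Complex.I) : ℂ) := by fun_prop
      simpa using (this.tendsto 0).mono_left nhdsWithin_le_nhds
    refine mem_closure_of_tendsto ((OnePoint.continuous_coe.tendsto _).comp hlim) ?_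
    filter_upwards [self_mem_nhdsWithin] with t ht using hmem x ht

theorem mapsTo_halfSphere_of_isPreconnected {X : Type*} [TopologicalSpace X] {F : X → OnePoint ℂ}
    {T : Set X} (hT : IsPreconnected T) (hF : ContinuousOn F T)
    (hreal : ∀ z ∈ T, F z ∉ extendedRealLine) (hs : s ≠ 0) :
    MapsTo F T (halfSphere s) ∨ MapsTo F T (halfSphere (-s)) := by
  simp only [mapsTo_iff_image_subset]
  refine isPreconnected_iff_subset_of_disjoint.1 (hT.image F hF) _ _ isOpen_halfSphere
    isOpen_halfSphere ?_ (by simp [disjoint_halfSphere_neg.inter_eq])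
  rintro _ ⟨z, hz, rfl⟩
  exact mem_halfSphere_or_mem_halfSphere_neg hs (hreal z hz)

end HalfSphere

section RealOnRealLine

theorem image_mem_nhds_of_continuousOn_of_injOn {φ : ℝ → ℝ} {N : Set ℝ} {x : ℝ} (hN : N ∈ 𝓝 x)
    (hφ : ContinuousOn φ N) (hinj : InjOn φ N) : φ '' N ∈ 𝓝 (φ x) := by
  obtain ⟨a, b, hx, hab⟩ := mem_nhds_iff_exists_Ioo_subset.1 hN
  obtain ⟨a', ha, hax⟩ := exists_between hx.1
  obtain ⟨b', hxb, hb⟩ := exists_between hx.2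
  have hsub : Icc a' b' ⊆ N := (Icc_subset_Ioo ha hb).trans hab
  have hle : a' ≤ b' := (hax.trans hxb).le
  have hxm : x ∈ Icc a' b' := ⟨hax.le, hxb.le⟩
  rcases (hφ.mono hsub).strictMonoOn_of_injOn_Icc' hle (hinj.mono hsub) with hmono | hanti
  · exact mem_of_superset (Icc_mem_nhds (hmono (left_mem_Icc.2 hle) hxm hax)
      (hmono hxm (right_mem_Icc.2 hle) hxb))
      ((intermediate_value_Icc hle (hφ.mono hsub)).trans (image_mono hsub))
  · exact mem_of_superset (Icc_mem_nhds (hanti hxm (right_mem_Icc.2 hle) hxb)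
      (hanti (left_mem_Icc.2 hle) hxm hax))
      ((intermediate_value_Icc' hle (hφ.mono hsub)).trans (image_mono hsub))

theorem eventually_mem_range_of_map_mem_range {E Y : Type*} [TopologicalSpace E]
    [TopologicalSpace Y] {F : E → Y} (hF : IsLocalHomeomorph F) {ι : ℝ → Y} (hι : IsEmbedding ι)
    {j : ℝ → E} (hj : Continuous j) (hj_inj : Function.Injective j) {x : ℝ}
    (h : ∀ᶠ t in 𝓝 x, F (j t) ∈ range ι) :
    ∀ᶠ z in 𝓝 (j x), F z ∈ range ι → z ∈ range j := by
  obtain ⟨q, hq, rfl⟩ := hF (j x)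
  let N : Set ℝ := {t | j t ∈ q.source ∧ q (j t) ∈ range ι}
  have hN : N ∈ 𝓝 x := inter_mem (hj.continuousAt (q.open_source.mem_nhds hq)) h
  choose! φ hφ using fun t (ht : t ∈ N) => ht.2
  have hcont : ContinuousOn φ N := hι.continuousOn_iff.2
    ((hF.continuous.comp hj).continuousOn.congr hφ)
  have hinj : InjOn φ N := fun t ht t' ht' htt' => hj_inj <| q.injOn ht.1 ht'.1 <| by
    rw [← hφ t ht, ← hφ t' ht', htt']
  obtain ⟨W, hW, hWφ⟩ := hι.isInducing.nhds_eq_comap (φ x) ▸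
    image_mem_nhds_of_continuousOn_of_injOn hN hcont hinj
  rw [hφ x (mem_of_mem_nhds hN)] at hW
  filter_upwards [q.open_source.mem_nhds hq, hF.continuous.continuousAt hW]
  rintro z hz hzW ⟨r, hr⟩
  obtain ⟨t, ht, rfl⟩ := hWφ (show ι r ∈ W from hr ▸ hzW)
  exact ⟨t, q.injOn ht.1 hz ((hφ t ht).symm.trans hr)⟩

variable {F : ℂ → OnePoint ℂ}

theorem eventually_im_eq_zero_of_ne_infty (hF : IsLocalHomeomorph F)
    (hreal : ∀ x : ℝ, F x ∈ extendedRealLine) {x : ℝ} (hx : F x ≠ OnePoint.infty) :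
    ∀ᶠ z in 𝓝 (x : ℂ), F z ∈ extendedRealLine → z.im = 0 := by
  have hfinite : ∀ᶠ z in 𝓝 (x : ℂ), F z ≠ OnePoint.infty :=
    hF.continuous.continuousAt.eventually_ne hx
  have hι : IsEmbedding fun r : ℝ => ((r : ℂ) : OnePoint ℂ) :=
    OnePoint.isOpenEmbedding_coe.isEmbedding.comp Complex.isometry_ofReal.isEmbedding
  have hfinite_real : ∀ᶠ t : ℝ in 𝓝 x, F t ≠ OnePoint.infty :=
    (Complex.continuous_ofReal.tendsto x).eventually hfinite
  filter_upwards [hfinite, eventually_mem_range_of_map_mem_range hF hι Complex.continuous_ofReal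
    Complex.ofReal_injective (hfinite_real.mono fun t ht => (hreal t).resolve_left ht)]
    with z hz hrange hzreal
  obtain ⟨t, rfl⟩ := hrange (hzreal.resolve_left hz)
  exact Complex.ofReal_im t

theorem eventually_im_eq_zero_of_mem_extendedRealLine (hF : IsLocalHomeomorph F)
    (hreal : ∀ x : ℝ, F x ∈ extendedRealLine) (x : ℝ) :
    ∀ᶠ z in 𝓝 (x : ℂ), F z ∈ extendedRealLine → z.im = 0 := by
  by_cases hx : F x = OnePoint.infty
  · have := eventually_im_eq_zero_of_ne_infty (F := sphereInv ∘ F) (x := x)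
      (isHomeomorph_sphereInv.isOpenEmbedding.isLocalHomeomorph.comp hF)
      (fun t => sphereInv_mem_extendedRealLine_iff.2 (hreal t))
      (by simp [hx, sphereInv_infty])
    simpa only [Function.comp_apply, sphereInv_mem_extendedRealLine_iff] using this
  · exact eventually_im_eq_zero_of_ne_infty hF hreal hx

theorem exists_pos_forall_mem_reProdIm {Q : ℂ → Prop} {a b : ℝ}
    (h : ∀ u ∈ Icc a b, ∀ᶠ z in 𝓝 (u : ℂ), Q z) :
    ∃ ε > 0, ∀ z ∈ Icc a b ×ℂ Ioo (-ε) ε, Q z := by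
  have hnear : ∀ u ∈ Icc a b, ∀ᶠ r : ℝ × ℝ in 𝓝 ((0 : ℝ), u), Q (r.2 + r.1 * Complex.I) := by
    intro u hu
    have hcont : Continuous fun r : ℝ × ℝ => (r.2 + r.1 * Complex.I : ℂ) := by fun_prop
    have hlim := hcont.tendsto ((0 : ℝ), u)
    simp only [Complex.ofReal_zero, zero_mul, add_zero] at hlim
    exact hlim.eventually (h u hu)
  obtain ⟨ε, hε, hQ⟩ := Metric.eventually_nhds_iff.1
    ((isCompact_Icc (a := a) (b := b)).eventually_forall_of_forall_eventually
      (P := fun v u : ℝ => Q (u + v * Complex.I)) hnear)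
  refine ⟨ε, hε, fun z ⟨hre, him⟩ => ?_⟩
  have := hQ (y := z.im) (by simpa [abs_lt] using him) z.re hre
  rwa [Complex.re_add_im] at this

theorem convex_reProdIm {I J : Set ℝ} (hI : Convex ℝ I) (hJ : Convex ℝ J) : Convex ℝ (I ×ℂ J) :=
  (hI.linear_preimage Complex.reLm).inter (hJ.linear_preimage Complex.imLm)

theorem frequently_mem_halfSphere (hF : IsLocalHomeomorph F) {z₀ : ℂ}
    (hz₀ : F z₀ ∈ extendedRealLine) {s : ℝ} (hs : s ≠ 0) :
    ∃ᶠ z in 𝓝 z₀, F z ∈ halfSphere s := by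
  have := mem_closure_iff_frequently.1 (extendedRealLine_subset_closure_halfSphere hs hz₀)
  rwa [← hF.map_nhds_eq, frequently_map] at this

theorem map_mem_extendedRealLine_of_im_eq_zero (hreal : ∀ x : ℝ, F x ∈ extendedRealLine) {z : ℂ}
    (hz : z.im = 0) : F z ∈ extendedRealLine := by
  have hre : ((z.re : ℝ) : ℂ) = z := Complex.ext (by simp) (by simp [hz])
  exact hre ▸ hreal z.re

theorem reProdIm_mem_nhds_ofReal {a b u ε : ℝ} (hu : u ∈ Ioo a b) (hε : 0 < ε) :
    Ioo a b ×ℂ Ioo (-ε) ε ∈ 𝓝 (u : ℂ) :=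
  (isOpen_Ioo.reProdIm isOpen_Ioo).mem_nhds ⟨hu, neg_lt_zero.2 hε, hε⟩

/-- Otherwise `F` would fold a neighbourhood of a point of `(a, b)` onto one side of the real
line. -/
theorem mapsTo_halfSphere_neg_of_mapsTo_halfSphere (hF : IsLocalHomeomorph F)
    (hreal : ∀ x : ℝ, F x ∈ extendedRealLine) {a b ε s : ℝ} (hab : a < b) (hε : 0 < ε)
    (hstrip : ∀ z ∈ Ioo a b ×ℂ Ioo (-ε) ε, F z ∈ extendedRealLine → z.im = 0) (hs : s ≠ 0)
    (hupper : MapsTo F (Ioo a b ×ℂ Ioo 0 ε) (halfSphere s)) :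
    MapsTo F (Ioo a b ×ℂ Ioo (-ε) 0) (halfSphere (-s)) := by
  refine (mapsTo_halfSphere_of_isPreconnected
    (convex_reProdIm (convex_Ioo a b) (convex_Ioo (-ε) 0)).isPreconnected
    hF.continuous.continuousOn (fun z ⟨hre, him⟩ h => him.2.ne
      (hstrip z ⟨hre, him.1, him.2.trans hε⟩ h)) hs).resolve_left fun hsame => ?_
  obtain ⟨u, hu⟩ := nonempty_Ioo.2 hab
  obtain ⟨z, hz, hre, him⟩ := ((frequently_mem_halfSphere hF (hreal u)
    (neg_ne_zero.2 hs)).and_eventually (reProdIm_mem_nhds_ofReal hu hε)).exists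
  rcases lt_trichotomy z.im 0 with h | h | h
  · exact disjoint_left.1 disjoint_halfSphere_neg (hsame ⟨hre, him.1, h⟩) hz
  · exact disjoint_left.1 disjoint_halfSphere_extendedRealLine hz
      (map_mem_extendedRealLine_of_im_eq_zero hreal h)
  · exact disjoint_left.1 disjoint_halfSphere_neg (hupper ⟨hre, h, him.2⟩) hz

/-- `S` is a strip on one side of `(a, b)`. -/
theorem exists_isPreconnected_mapsTo_halfSphere (hF : IsLocalHomeomorph F)
    (hreal : ∀ x : ℝ, F x ∈ extendedRealLine) (a b : ℝ) :
    ∃ (S : Set ℂ) (s : ℝ), s ≠ 0 ∧ IsPreconnected S ∧ MapsTo F S (halfSphere s) ∧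
      ∀ u ∈ Ioo a b, ∀ᶠ z in 𝓝 (u : ℂ), F z ∈ halfSphere s → z ∈ S := by
  obtain ⟨ε, hε, hclosed⟩ := exists_pos_forall_mem_reProdIm (a := a) (b := b) fun u _ =>
    eventually_im_eq_zero_of_mem_extendedRealLine hF hreal u
  have hstrip : ∀ z ∈ Ioo a b ×ℂ Ioo (-ε) ε, F z ∈ extendedRealLine → z.im = 0 :=
    fun z hz => hclosed z ⟨Ioo_subset_Icc_self hz.1, hz.2⟩
  have hconn : IsPreconnected (Ioo a b ×ℂ Ioo 0 ε) :=
    (convex_reProdIm (convex_Ioo a b) (convex_Ioo 0 ε)).isPreconnected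
  obtain ⟨s, hs, hupper⟩ : ∃ s : ℝ, s ≠ 0 ∧ MapsTo F (Ioo a b ×ℂ Ioo 0 ε) (halfSphere s) :=
    (mapsTo_halfSphere_of_isPreconnected hconn hF.continuous.continuousOn (fun z ⟨hre, him⟩ h =>
      him.1.ne' (hstrip z ⟨hre, by linarith [him.1], him.2⟩ h)) one_ne_zero).elim
      (fun h => ⟨1, one_ne_zero, h⟩) fun h => ⟨-1, by norm_num, h⟩
  refine ⟨Ioo a b ×ℂ Ioo 0 ε, s, hs, hconn, hupper, fun u hu => ?_⟩
  have hlower := mapsTo_halfSphere_neg_of_mapsTo_halfSphere hF hreal (hu.1.trans hu.2) hε hstrip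
    hs hupper
  filter_upwards [reProdIm_mem_nhds_ofReal hu hε] with z ⟨hre, him⟩ hz
  rcases lt_trichotomy z.im 0 with h | h | h
  · exact absurd (hlower ⟨hre, him.1, h⟩) (disjoint_left.1 disjoint_halfSphere_neg hz)
  · exact absurd (map_mem_extendedRealLine_of_im_eq_zero hreal h)
      (disjoint_left.1 disjoint_halfSphere_extendedRealLine hz)
  · exact ⟨hre, h, him.2⟩

theorem eq_of_injOn_of_mem_closure {E Y : Type*} [TopologicalSpace E] [T2Space E]
    [TopologicalSpace Y] {p : E → Y} (hp : IsOpenMap p) {S : Set E} (hS : InjOn p S) {K : Set Y}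
    {x y : E} (hxK : p x ∈ closure K) (hx : ∀ᶠ z in 𝓝 x, p z ∈ K → z ∈ S)
    (hy : ∀ᶠ z in 𝓝 y, p z ∈ K → z ∈ S) (hxy : p x = p y) : x = y := by
  by_contra hne
  obtain ⟨U, V, hU, hV, hUV⟩ := t2_separation_nhds hne
  obtain ⟨w, hw, ⟨z, ⟨hzU, hzS⟩, rfl⟩, z', ⟨hzV, hzS'⟩, hzz'⟩ :=
    ((mem_closure_iff_frequently.1 hxK).and_eventually (inter_mem
      (hp.image_mem_nhds (inter_mem hU hx)) (hxy ▸ hp.image_mem_nhds (inter_mem hV hy)))).exists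
  exact disjoint_left.1 hUV hzU (hS (hzS' (hzz' ▸ hw)) (hzS hw) hzz' ▸ hzV)

theorem injective_of_isLocalHomeomorph (hF : IsLocalHomeomorph F)
    (hreal : ∀ x : ℝ, F x ∈ extendedRealLine)
    (hasymp : ∀ a, HasAsymptoticValue F a → a ∈ extendedRealLine) :
    Function.Injective fun x : ℝ => F x := by
  intro x y hxy
  obtain ⟨S, s, hs, hS, hSs, hcollar⟩ :=
    exists_isPreconnected_mapsTo_halfSphere hF hreal (min x y - 1) (max x y + 1)
  have hinj : InjOn F S := injOn_of_isSimplyConnected hF (isSimplyConnected_halfSphere hs)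
    (fun w hw hw' => disjoint_left.1 disjoint_halfSphere_extendedRealLine hw (hasymp w hw')) hS hSs
  have hx : x ∈ Ioo (min x y - 1) (max x y + 1) :=
    ⟨by linarith [min_le_left x y], by linarith [le_max_left x y]⟩
  have hy : y ∈ Ioo (min x y - 1) (max x y + 1) :=
    ⟨by linarith [min_le_right x y], by linarith [le_max_right x y]⟩
  exact Complex.ofReal_injective <| eq_of_injOn_of_mem_closure hF.isOpenMap hinj
    (extendedRealLine_subset_closure_halfSphere hs (hreal x)) (hcollar x hx) (hcollar y hy) hxy

end RealOnRealLine

section MeromorphicDerivative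

variable {𝕜 : Type*} [NontriviallyNormedField 𝕜] {f : 𝕜 → 𝕜} {z₀ : 𝕜}

theorem logDeriv_sub_zpow_mul {m : ℤ} {u : 𝕜 → 𝕜} {z : 𝕜} (hz : z ≠ z₀) (hu : u z ≠ 0)
    (hud : DifferentiableAt 𝕜 u z) :
    logDeriv (fun w => (w - z₀) ^ m * u w) z = m / (z - z₀) + logDeriv u z := by
  have hsub : z - z₀ ≠ 0 := sub_ne_zero.2 hz
  have hd : DifferentiableAt 𝕜 (fun w => w - z₀) z := by fun_prop
  rw [logDeriv_mul (f := fun w => (w - z₀) ^ m) z (zpow_ne_zero m hsub) hu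
    (hd.zpow (Or.inl hsub)) hud, logDeriv_fun_zpow hd, logDeriv_apply, deriv_sub_const, deriv_id'',
    mul_one_div]

theorem meromorphicOrderAt_ne_top_of_deriv (hf : meromorphicOrderAt (deriv f) z₀ ≠ ⊤) :
    meromorphicOrderAt f z₀ ≠ ⊤ := by
  contrapose! hf
  have hzero : f =ᶠ[𝓝[≠] z₀] fun _ => 0 := meromorphicOrderAt_eq_top_iff.1 hf
  rw [meromorphicOrderAt_eq_top_iff]
  filter_upwards [hzero.nhdsNE_deriv] with z hz
  rw [hz, deriv_const]

variable [CompleteSpace 𝕜]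

theorem exists_analyticAt_logDeriv_eq {g : 𝕜 → 𝕜} (hg : MeromorphicAt g z₀) {m : ℤ}
    (hm : meromorphicOrderAt g z₀ = m) :
    ∃ ℓ : 𝕜 → 𝕜, AnalyticAt 𝕜 ℓ z₀ ∧ logDeriv g =ᶠ[𝓝[≠] z₀] fun z => m / (z - z₀) + ℓ z := by
  obtain ⟨u, hu, hu0, hgu⟩ := (meromorphicOrderAt_eq_int_iff hg).1 hm
  refine ⟨logDeriv u, hu.deriv.div hu hu0, ?_⟩
  filter_upwards [logDeriv_congr_nhdsNE hgu, self_mem_nhdsWithin,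
    (hu.continuousAt.eventually_ne hu0).filter_mono nhdsWithin_le_nhds,
    hu.eventually_analyticAt.filter_mono nhdsWithin_le_nhds] with z hz hne hu0 hu
  rw [hz]
  exact logDeriv_sub_zpow_mul hne hu0 hu.differentiableAt

theorem meromorphicOrderAt_deriv_nonneg (hf : MeromorphicAt f z₀)
    (hnonneg : 0 ≤ meromorphicOrderAt f z₀) : 0 ≤ meromorphicOrderAt (deriv f) z₀ := by
  rw [meromorphicOrderAt_congr hf.eq_nhdsNE_toMeromorphicNFAt.nhdsNE_deriv]
  exact (hf.meromorphicOrderAt_nonneg_iff_analyticAt_toMeromorphicNFAt.1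
    hnonneg).deriv.meromorphicOrderAt_nonneg

variable [CharZero 𝕜]

theorem meromorphicOrderAt_eq_deriv_add_one (hneg : meromorphicOrderAt f z₀ < 0) :
    meromorphicOrderAt f z₀ = meromorphicOrderAt (deriv f) z₀ + 1 := by
  obtain ⟨n, hn⟩ := WithTop.ne_top_iff_exists.1 hneg.ne_top
  rw [← hn] at hneg
  have hn0 : n ≠ 0 := by exact_mod_cast hneg.ne
  rw [meromorphicOrderAt_deriv_eq_sub_one (by exact_mod_cast hn0) hn.symm, ← hn]
  exact congrArg WithTop.some (sub_add_cancel n 1).symm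

theorem meromorphicOrderAt_nonneg_of_deriv_eq_zero (hf' : meromorphicOrderAt (deriv f) z₀ = 0) :
    0 ≤ meromorphicOrderAt f z₀ := by
  by_contra! hneg
  have hone := meromorphicOrderAt_eq_deriv_add_one hneg
  rw [hf', zero_add] at hone
  exact absurd (hone ▸ hneg) (by decide)

theorem meromorphicOrderAt_inv_eq_one_of_deriv (hf : MeromorphicAt f z₀)
    (hf' : meromorphicOrderAt (deriv f) z₀ = (-2 : ℤ)) :
    meromorphicOrderAt f⁻¹ z₀ = (1 : ℤ) := by
  have hneg : meromorphicOrderAt f z₀ < 0 := by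
    by_contra! hnonneg
    exact absurd (hf' ▸ meromorphicOrderAt_deriv_nonneg hf hnonneg) (by decide)
  rw [meromorphicOrderAt_inv, meromorphicOrderAt_eq_deriv_add_one hneg, hf']
  rfl

end MeromorphicDerivative

section LocalHomeomorphAt

theorem isLocalHomeomorphOn_singleton_of_eventuallyEq {X Y : Type*} [TopologicalSpace X]
    [TopologicalSpace Y] {F G : X → Y} {x : X} (hG : IsLocalHomeomorphOn G {x})
    (hFG : F =ᶠ[𝓝 x] G) : IsLocalHomeomorphOn F {x} := by
  obtain ⟨e, hxe, rfl⟩ := hG x rfl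
  obtain ⟨U, hU, hUo, hxU⟩ := eventually_nhds_iff.1 hFG
  refine IsLocalHomeomorphOn.mk F {x} ?_
  rintro _ rfl
  refine ⟨e.restrOpen U hUo, ?_, ?_⟩
  · rw [e.restrOpen_source]
    exact ⟨hxe, hxU⟩
  · rw [e.restrOpen_source]
    exact fun y hy => hU y hy.2

theorem isLocalHomeomorphOn_singleton_of_deriv_ne_zero {𝕜 : Type*} [RCLike 𝕜] {g : 𝕜 → 𝕜} {z : 𝕜}
    (hg : AnalyticAt 𝕜 g z) (hg' : deriv g z ≠ 0) : IsLocalHomeomorphOn g {z} := by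
  have hstrict := hg.hasStrictDerivAt.hasStrictFDerivAt_equiv hg'
  rintro _ rfl
  exact ⟨hstrict.toOpenPartialHomeomorph g, hstrict.mem_toOpenPartialHomeomorph_source, rfl⟩

end LocalHomeomorphAt

section ToSphere

variable {f h : ℂ → ℂ} {z₀ : ℂ}

theorem schwarzian_eq_deriv_logDeriv {z : ℂ} (hf : AnalyticAt ℂ (deriv f) z)
    (hz : deriv f z ≠ 0) :
    schwarzian f z = deriv (logDeriv (deriv f)) z - logDeriv (deriv f) z ^ 2 / 2 := by
  have hquot : deriv (logDeriv (deriv f)) z = _ :=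
    deriv_div hf.deriv.differentiableAt hf.differentiableAt hz
  rw [hquot, schwarzian, iteratedDeriv_succ, iteratedDeriv_succ, iteratedDeriv_one,
    logDeriv_apply]
  field_simp
  ring

/-- The double pole comes from the term `m / (z - z₀)` of `f'' / f'`. -/
theorem tendsto_sub_sq_mul_schwarzian (hf : MeromorphicAt f z₀) {m : ℤ}
    (hm : meromorphicOrderAt (deriv f) z₀ = m) :
    Tendsto (fun z => (z - z₀) ^ 2 * schwarzian f z) (𝓝[≠] z₀) (𝓝 (-(m * (m + 2)) / 2)) := by
  have hne : ∀ᶠ z in 𝓝[≠] z₀, deriv f z ≠ 0 :=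
    (meromorphicOrderAt_ne_top_iff_eventually_ne_zero hf.deriv).1 (hm ▸ WithTop.coe_ne_top)
  obtain ⟨ℓ, hℓ, hlog⟩ := exists_analyticAt_logDeriv_eq hf.deriv hm
  have hcont : ContinuousAt (fun z => -(m : ℂ) + (z - z₀) ^ 2 * deriv ℓ z
      - (m + (z - z₀) * ℓ z) ^ 2 / 2) z₀ := by
    have := hℓ.continuousAt
    have := hℓ.deriv.continuousAt
    fun_prop
  have hlim := hcont.tendsto.mono_left (nhdsWithin_le_nhds (s := {z₀}ᶜ))
  rw [show -(m : ℂ) + (z₀ - z₀) ^ 2 * deriv ℓ z₀ - (m + (z₀ - z₀) * ℓ z₀) ^ 2 / 2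
    = -(m * (m + 2)) / 2 by ring] at hlim
  refine hlim.congr' ?_
  filter_upwards [hne, hf.deriv.eventually_analyticAt, hlog, hlog.nhdsNE_deriv,
    hℓ.eventually_analyticAt.filter_mono nhdsWithin_le_nhds, self_mem_nhdsWithin]
    with z hz han hlogz hlogz' hℓz hzz₀
  have hsub : z - z₀ ≠ 0 := sub_ne_zero.2 hzz₀
  have hderiv : HasDerivAt (fun w => m / (w - z₀) + ℓ w) (-m / (z - z₀) ^ 2 + deriv ℓ z) z := by
    simpa using ((hasDerivAt_const z (m : ℂ)).fun_div ((hasDerivAt_id z).sub_const z₀)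
      hsub).fun_add hℓz.differentiableAt.hasDerivAt
  rw [schwarzian_eq_deriv_logDeriv han hz, hlogz', hlogz, hderiv.deriv]
  field_simp

theorem meromorphicOrderAt_deriv_eq_zero_or_of_schwarzian_eq (hf : MeromorphicAt f z₀)
    (hh : ContinuousAt h z₀) (hS : ∀ᶠ z in 𝓝[≠] z₀, deriv f z ≠ 0 ∧ schwarzian f z = h z) :
    meromorphicOrderAt (deriv f) z₀ = 0 ∨ meromorphicOrderAt (deriv f) z₀ = (-2 : ℤ) := by
  obtain ⟨m, hm⟩ := WithTop.ne_top_iff_exists.1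
    ((meromorphicOrderAt_ne_top_iff_eventually_ne_zero hf.deriv).2 (hS.mono fun z hz => hz.1))
  have hcont : ContinuousAt (fun z => (z - z₀) ^ 2 * h z) z₀ := by fun_prop
  have hzero : Tendsto (fun z => (z - z₀) ^ 2 * schwarzian f z) (𝓝[≠] z₀) (𝓝 0) := by
    simpa using (hcont.tendsto.mono_left nhdsWithin_le_nhds).congr'
      (hS.mono fun z hz => congrArg _ hz.2.symm)
  have hindicial : (m : ℂ) * (m + 2) = 0 := by
    linear_combination -2 * tendsto_nhds_unique (tendsto_sub_sq_mul_schwarzian hf hm.symm) hzero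
  have hint : m * (m + 2) = 0 := by exact_mod_cast hindicial
  rw [← hm]
  rcases mul_eq_zero.1 hint with hm0 | hm2
  · exact Or.inl (by rw [hm0]; rfl)
  · exact Or.inr (by rw [eq_neg_of_add_eq_zero_left hm2])

theorem toSphere_eq_of_eventuallyEq {g : ℂ → ℂ} {z : ℂ} (hfg : f =ᶠ[𝓝[≠] z] g)
    (hg : AnalyticAt ℂ g z) : toSphere f z = (g z : OnePoint ℂ) := by
  rw [toSphere, if_neg, (toMeromorphicNFAt_eventuallyEq_nhds_congr hfg).eq_of_nhds,
    toMeromorphicNFAt_eq_self.2 hg.meromorphicNFAt]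
  rw [meromorphicOrderAt_congr hfg]
  exact not_lt.2 hg.meromorphicOrderAt_nonneg

theorem toSphere_of_meromorphicOrderAt_neg {z : ℂ} (hneg : meromorphicOrderAt f z < 0) :
    toSphere f z = OnePoint.infty := if_pos hneg

theorem toSphere_of_meromorphicOrderAt_pos {z : ℂ} (hpos : 0 < meromorphicOrderAt f z) :
    toSphere f z = ((0 : ℂ) : OnePoint ℂ) := by
  rw [toSphere, if_neg hpos.not_gt, toMeromorphicNFAt_of_meromorphicOrderAt_ne_zero hpos.ne']

theorem toSphere_inv {z : ℂ} (hf : MeromorphicAt f z) (htop : meromorphicOrderAt f z ≠ ⊤) :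
    toSphere f⁻¹ z = sphereInv (toSphere f z) := by
  obtain ⟨n, hn⟩ := WithTop.ne_top_iff_exists.1 htop
  have hinv : meromorphicOrderAt f⁻¹ z = (-n : ℤ) := by rw [meromorphicOrderAt_inv, ← hn]; rfl
  rcases lt_trichotomy n 0 with h | rfl | h
  · rw [toSphere_of_meromorphicOrderAt_neg (f := f) (by rw [← hn]; exact_mod_cast h),
      sphereInv_infty, toSphere_of_meromorphicOrderAt_pos]
    rw [hinv]
    exact_mod_cast neg_pos.2 h
  · have hg : AnalyticAt ℂ (toMeromorphicNFAt f z) z :=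
      hf.meromorphicOrderAt_nonneg_iff_analyticAt_toMeromorphicNFAt.1 hn.le
    have hg0 : toMeromorphicNFAt f z z ≠ 0 :=
      hf.meromorphicOrderAt_eq_zero_iff_toMeromorphicNFAt_ne_zero.1 hn.symm
    rw [toSphere_eq_of_eventuallyEq hf.eq_nhdsNE_toMeromorphicNFAt hg, sphereInv_coe hg0]
    exact toSphere_eq_of_eventuallyEq hf.eq_nhdsNE_toMeromorphicNFAt.inv (hg.inv hg0)
  · rw [toSphere_of_meromorphicOrderAt_pos (f := f) (by rw [← hn]; exact_mod_cast h),
      sphereInv_zero, toSphere_of_meromorphicOrderAt_neg]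
    rw [hinv]
    exact_mod_cast neg_lt_zero.2 h

theorem toSphere_eventuallyEq_coe {g : ℂ → ℂ} (hfg : f =ᶠ[𝓝[≠] z₀] g) (hg : AnalyticAt ℂ g z₀) :
    toSphere f =ᶠ[𝓝 z₀] fun z => (g z : OnePoint ℂ) := by
  have hpunctured : ∀ᶠ z in 𝓝[≠] z₀, f =ᶠ[𝓝[≠] z] g := by
    filter_upwards [eventually_eventually_nhdsWithin.2 hfg, self_mem_nhdsWithin] with z hz hne
    rw [isOpen_compl_singleton.nhdsWithin_eq hne] at hz
    exact hz.filter_mono nhdsWithin_le_nhds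
  have hnear : ∀ᶠ z in 𝓝 z₀, f =ᶠ[𝓝[≠] z] g := by
    filter_upwards [eventually_nhdsWithin_iff.1 hpunctured] with z hz
    rcases eq_or_ne z z₀ with rfl | hne
    · exact hfg
    · exact hz hne
  filter_upwards [hnear, hg.eventually_analyticAt] with z hz hgz using
    toSphere_eq_of_eventuallyEq hz hgz

theorem isLocalHomeomorphOn_toSphere_of_deriv (hf : MeromorphicAt f z₀)
    (hf' : meromorphicOrderAt (deriv f) z₀ = 0) :
    IsLocalHomeomorphOn (toSphere f) {z₀} := by
  have hfg := hf.eq_nhdsNE_toMeromorphicNFAt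
  have hg : AnalyticAt ℂ (toMeromorphicNFAt f z₀) z₀ :=
    hf.meromorphicOrderAt_nonneg_iff_analyticAt_toMeromorphicNFAt.1
      (meromorphicOrderAt_nonneg_of_deriv_eq_zero hf')
  have hg' : deriv (toMeromorphicNFAt f z₀) z₀ ≠ 0 := by
    rw [← hg.deriv.meromorphicNFAt.meromorphicOrderAt_eq_zero_iff,
      ← meromorphicOrderAt_congr hfg.nhdsNE_deriv, hf']
  exact isLocalHomeomorphOn_singleton_of_eventuallyEq
    ((OnePoint.isOpenEmbedding_coe.isLocalHomeomorph.isLocalHomeomorphOn (s := univ)).comp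
      (isLocalHomeomorphOn_singleton_of_deriv_ne_zero hg hg') (mapsTo_univ _ _))
    (toSphere_eventuallyEq_coe hfg hg)

theorem isLocalHomeomorphOn_toSphere_inv (hf : MeromorphicAt f z₀)
    (hf' : meromorphicOrderAt (deriv f) z₀ = (-2 : ℤ)) :
    IsLocalHomeomorphOn (toSphere f⁻¹) {z₀} := by
  refine isLocalHomeomorphOn_toSphere_of_deriv hf.inv ?_
  rw [meromorphicOrderAt_deriv_eq_sub_one (by simp) (meromorphicOrderAt_inv_eq_one_of_deriv hf hf')]
  simp

theorem isLocalHomeomorph_toSphere (hf : Meromorphic f)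
    (hf' : ∀ z, meromorphicOrderAt (deriv f) z = 0 ∨ meromorphicOrderAt (deriv f) z = (-2 : ℤ)) :
    IsLocalHomeomorph (toSphere f) := by
  have htop (z : ℂ) : meromorphicOrderAt f z ≠ ⊤ := meromorphicOrderAt_ne_top_of_deriv <| by
    rcases hf' z with h | h <;> simp [h]
  have hinv : toSphere f = sphereInv ∘ toSphere f⁻¹ := funext fun z => by
    rw [Function.comp_apply, toSphere_inv (hf z) (htop z), sphereInv_involutive]
  intro z
  rcases hf' z with h | h
  · exact isLocalHomeomorphOn_toSphere_of_deriv (hf z) h z rfl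
  · rw [hinv]
    exact (isHomeomorph_sphereInv.isOpenEmbedding.isLocalHomeomorph.isLocalHomeomorphOn
      (s := univ)).comp (isLocalHomeomorphOn_toSphere_inv (hf z) h) (mapsTo_univ _ _) z rfl

end ToSphere

theorem mainTheorem4_general {f h : ℂ → ℂ} (hf : Meromorphic f) (hh : Continuous h)
    (hS : ∀ᶠ z in codiscrete ℂ, deriv f z ≠ 0 ∧ schwarzian f z = h z) (hreal : IsReal f)
    (hasymp : ∀ a, IsAsymptoticValue f a → a ∈ extendedRealLine) :
    Function.Injective fun x : ℝ => toSphere f x := by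
  have hS' (z : ℂ) : ∀ᶠ w in 𝓝[≠] z, deriv f w ≠ 0 ∧ schwarzian f w = h w := by
    have := disjoint_principal_right.1 (mem_codiscrete.1 hS z)
    rwa [compl_compl] at this
  have hloc : IsLocalHomeomorph (toSphere f) := isLocalHomeomorph_toSphere hf fun z =>
    meromorphicOrderAt_deriv_eq_zero_or_of_schwarzian_eq (hf z) hh.continuousAt (hS' z)
  exact injective_of_isLocalHomeomorph hloc hreal hasymp

end NevanlinnaFunctions

theorem mainTheorem4 (f : ℂ → ℂ)
    (hf : NevanlinnaFunctions.IsNevanlinna f)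
    (hreal : NevanlinnaFunctions.IsReal f)
    (hlog : NevanlinnaFunctions.HasAtLeastLogSingularities f 3)
    (hasymp : ∀ a : OnePoint ℂ, NevanlinnaFunctions.IsAsymptoticValue f a →
      a ∈ NevanlinnaFunctions.extendedRealLine) :
    {x : ℝ | NevanlinnaFunctions.toSphere f x = ((0 : ℂ) : OnePoint ℂ)}.Subsingleton := by
  obtain ⟨hmer, P, hP⟩ := hf
  exact fun x hx y hy => NevanlinnaFunctions.mainTheorem4_general hmer (by fun_prop) hP hreal hasymp
    (hx.trans hy.symm)
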